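/- **Setting.** Let $d\ge 3$, $N\ge 1$, $T\ge 0$ be integers. There are $T+1$ models, the target $t=0$ and the sources $t=1,\dots,T$; a sample from model $t$ has law $\mathcal N(\theta_t,\sigma_t^2 I_d)$ on $\mathbb R^d$, where the variances $\boldsymbol\Gamma=(\sigma_0^2,\dots,\sigma_T^2)\in[0,\infty)^{T+1}$ are known and $\boldsymbol\theta=(\theta_0,\dots,\theta_T)\in(\mathbb R^d)^{T+1}$ is unknown. A learner collects $N$ samples adaptively: with independent $Z_{i,t}\sim\mathcal N(\theta_t,\sigma_t^2I_d)$, in round $i$ it draws a model index $A_i\in\{0,\dots,T\}$ from a distribution $\pi_i$ that depends only on the history $(A_j,S_j)_{j<i}$, and observes $S_i=Z_{i,A_i}$; after $N$ rounds it outputs a (possibly randomized) estimate $\hat\theta$ based on $(A_i,S_i)_{i\le N}$. For $\boldsymbol\Psi\subseteq(\mathbb R^d)^{T+1}$ the minimax risk is $$L_{N,d}(\boldsymbol\Psi,\boldsymbol\Gamma)=\inf_{(\pi,\hat\theta)}\ \sup_{\boldsymbol\theta\in\boldsymbol\Psi}\ \mathbb E\,\|\hat\theta-\theta_0\|^2 .$$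 Let $\boldsymbol q=(q_0,\dots,q_T)\in\mathbb R^{T+1}$ with $q_0^2=0\le q_1^2\le\dots\le q_T^2$, and let $\sigma_0^2\ge\sigma_1^2\ge\dots\ge\sigma_T^2$. Put $$\boldsymbol\Psi_=(\boldsymbol q)=\bigcup_{\zeta\in\mathfrak S_T}\{\boldsymbol\theta:\ \|\theta_t-\theta_0\|^2=q_{\zeta(t)}^2\ \text{for all } 1\le t\le T\},\qquad \boldsymbol\Psi_*(r)=\{\boldsymbol\theta:\ \|\theta_t-\theta_0\|^2=r^2\ \text{for some } 1\le t\le T\}.$$ Let $\mathcal T_{\mathrm{wo}}=\{1\le t\le T:\ q_t^2\le d\sigma_0^2/N\}$ be the weak-oracle set with $\kappa=1$. Let $t_{\mathrm{wo}}=0$ if $\mathcal T_{\mathrm{wo}}=\emptyset$; otherwise let $t_{\mathrm{wo}}$ be an element of $\mathcal T_{\mathrm{wo}}$ of minimal $\sigma_t^2$ and, among those, of maximal $q_t^2$. Write $\sigma_{\mathrm{wo}}^2=\sigma_{t_{\mathrm{wo}}}^2$ and $q_{\mathrm{wo}}=q_{t_{\mathrm{wo}}}$. **Theorem.** For every $d\ge3$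 there is a constant $c(d)\ge e^{-5}$, depending only on $d$, such that for all $N$, $T$, $\boldsymbol\Gamma$, $\boldsymbol q$ as above: 1. If $d\sigma_{\mathrm{wo}}^2/N\ge q_{\mathrm{wo}}^2$, then $$L_{N,d}(\boldsymbol\Psi_=(\boldsymbol q),\boldsymbol\Gamma)\ \ge\ \frac{c(d)^2}{2}\cdot\frac{d\sigma_{\mathrm{wo}}^2}{N},$$ and, if moreover $\mathcal T_{\mathrm{wo}}\neq\emptyset$, then $L_{N,d}(\boldsymbol\Psi_*(q_{\mathrm{wo}}),\boldsymbol\Gamma)\ge L_{N,d}(\boldsymbol\Psi_=(\boldsymbol q),\boldsymbol\Gamma)$, so the same lower bound holds for $\boldsymbol\Psi_*(q_{\mathrm{wo}})$. 2. If $d\sigma_{\mathrm{wo}}^2/N<q_{\mathrm{wo}}^2$, then $$L_{N,d}(\boldsymbol\Psi_*(q_{\mathrm{wo}}),\boldsymbol\Gamma)\ \ge\ \frac{c(d)^2}{8}\cdot q_{\mathrm{wo}}^2 .$$ -/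

import Mathlib

open MeasureTheory ProbabilityTheory
open scoped ENNReal NNReal

noncomputable section

namespace CurriculumLearning

/-- The parameter and sample space `ℝ^d`, with its Euclidean norm. -/
abbrev Vec (d : ℕ) : Type := EuclideanSpace ℝ (Fin d)

/-- The models `{0, 1, …, T}`: `0` is the target, `1, …, T` are the sources. -/
abbrev ModelIdx (T : ℕ) : Type := Fin (T + 1)

/-- The history after `n` rounds: the chosen models and the samples collected. -/
abbrev History (d T n : ℕ) : Type := Fin n → ModelIdx T × Vec d

/-- The isotropic Gaussian law `N(θ, v • I_d)` on `ℝ^d` (a point mass if `v = 0`). -/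
def gaussianVec {d : ℕ} (θ : Vec d) (v : ℝ≥0) : Measure (Vec d) :=
  (Measure.pi fun k : Fin d => gaussianReal (θ k) v).map (WithLp.toLp 2)

/-- An adaptive algorithm: `policy i` is the conditional law of the model chosen in round `i`
(counted from `0`) given the history of the earlier rounds, and `estimator` is the, possibly
randomized, estimator of the target parameter given all `N` observations. -/
structure Algorithm (N d T : ℕ) where
  policy : (i : ℕ) → Kernel (History d T i) (ModelIdx T)
  policy_markov : ∀ i, IsMarkovKernel (policy i)
  estimator : Kernel (History d T N) (Vec d)
  estimator_markov : IsMarkovKernel estimator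

/-- One row `(Z_{i,t})_{0 ≤ t ≤ T}` of the random table: independent entries, `Z_{i,t}` of law
`N(θ t, σ2 t • I_d)`. -/
def tableRow {d T : ℕ} (σ2 : ModelIdx T → ℝ≥0) (θ : ModelIdx T → Vec d) :
    Measure (ModelIdx T → Vec d) :=
  Measure.pi fun t => gaussianVec (θ t) (σ2 t)

/-- Append the choice `a` and the sample `z a` (the entry of the table row `z` in the chosen
column) to a history. -/
def extendHistory {d T n : ℕ} (p : History d T n × (ModelIdx T × (ModelIdx T → Vec d))) :
    History d T (n + 1) :=
  Fin.snoc (α := fun _ => ModelIdx T × Vec d) p.1 (p.2.1, p.2.2 p.2.1)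

/-- The law of the history after `n` rounds: in each round a fresh row of the table, independent
of the past, and a choice drawn from the policy given the past, conditionally independent of that
row; the learner sees the entry of the row in the chosen column. -/
def historyLaw {N d T : ℕ} (A : Algorithm N d T) (σ2 : ModelIdx T → ℝ≥0)
    (θ : ModelIdx T → Vec d) : (n : ℕ) → Measure (History d T n)
  | 0 => Measure.dirac Fin.elim0
  | n + 1 =>
    ((historyLaw A σ2 θ n) ⊗ₘ (A.policy n ×ₖ Kernel.const _ (tableRow σ2 θ))).map extendHistory

/-- The risk `E ‖θ̂ - θ 0‖²` of an algorithm that collects `N` samples. -/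
def risk {N d T : ℕ} (A : Algorithm N d T) (σ2 : ModelIdx T → ℝ≥0)
    (θ : ModelIdx T → Vec d) : ℝ≥0∞ :=
  ∫⁻ h, ∫⁻ x, ENNReal.ofReal (‖x - θ 0‖ ^ 2) ∂(A.estimator h) ∂(historyLaw A σ2 θ N)

/-- The minimax risk over the parameters in `Ψ` for known noise variances `σ2`. -/
def minimaxRisk (N : ℕ) {d T : ℕ} (Ψ : Set (ModelIdx T → Vec d)) (σ2 : ModelIdx T → ℝ≥0) :
    ℝ≥0∞ :=
  ⨅ A : Algorithm N d T, ⨆ θ ∈ Ψ, risk A σ2 θ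

/-- The fully localized set `Ψ_=(q)`: up to a permutation of the sources, the distances of the
source parameters to the target parameter are `q 1, …, q T`. -/
def fullyLocalized (d : ℕ) {T : ℕ} (q : ModelIdx T → ℝ) : Set (ModelIdx T → Vec d) :=
  ⋃ ζ : Equiv.Perm (Fin T), {θ | ∀ t : Fin T, ‖θ t.succ - θ 0‖ ^ 2 = q (ζ t).succ ^ 2}

/-- The single localized-source set `Ψ_*(r)`: some source parameter is at distance `r` from the
target parameter. -/
def singleLocalized (d T : ℕ) (r : ℝ) : Set (ModelIdx T → Vec d) :=
  {θ | ∃ t : Fin T, ‖θ t.succ - θ 0‖ ^ 2 = r ^ 2}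

/-- The weak-oracle set (of source models) for the distances `q`. -/
def weakOracleSet (κ : ℝ) (N d : ℕ) {T : ℕ} (σ2 : ModelIdx T → ℝ≥0) (q : ModelIdx T → ℝ) :
    Set (ModelIdx T) :=
  {t | t ≠ 0 ∧ q t ^ 2 ≤ κ * (d * σ2 0 / N)}

/-- `t` is the model chosen by the weak oracle from the set `S` of sources: the target if `S` is
empty, otherwise a model of minimal noise variance in `S`, and among those one of maximal
distance. (All such `t` share the same variance and the same squared distance.) -/
def IsWeakOracleModel {T : ℕ} (σ2 : ModelIdx T → ℝ≥0) (q : ModelIdx T → ℝ)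
    (S : Set (ModelIdx T)) (t : ModelIdx T) : Prop :=
  (S = ∅ ∧ t = 0) ∨
    (t ∈ S ∧ (∀ s ∈ S, σ2 t ≤ σ2 s) ∧ ∀ s ∈ S, σ2 s = σ2 t → q s ^ 2 ≤ q t ^ 2)

end CurriculumLearning

end

/-! Two parameters that differ in one coordinate by at most `2σ_t/√N` in every model `t` cannot be
told apart, however the `N` samples are allocated. Closeness is measured by the squared Hellinger
affinity in dual form: it needs no common density, so zero variances are harmless, and it multiplies
along kernels. The policy contributes a factor 1 and each sample at least `e^{-1/N}`, so the output
has affinity at least `e^{-1}` (`Indistinguishable.affinityGE_outputLaw`).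
`AffinityGE.le_four_mul_add` turns this into a two-point bound, and `le_minimaxRisk_of_hypercube`
adds it up over coordinates, as in Assouad's lemma.

Two cubes then suffice. For part 1 (`le_minimaxRisk_fullyLocalized`), models at least as noisy as
the oracle's move with the target along a `(d-1)`-dimensional cube. The more precise ones stay fixed
on the orthogonal axis, equidistant from all vertices; there is room for this because they lie
outside the weak-oracle set and so are far from the target. For part 2
(`le_minimaxRisk_singleLocalized`), all sources sit at the centre of a cube of circumradius `q_wo`
with the target at a vertex. The sources then carry no information, and `q_wo² ≤ dσ_0²/N` hides the
vertex in the target noise. -/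

namespace CurriculumLearning

/-! ### Calculus of the dual Hellinger affinity -/

/-- The squared Hellinger affinity of `μ` and `ν` is at least `c`, in its dual form: the infimum of
`(∫ f ∂μ) * (∫ f⁻¹ ∂ν)` over positive `f` is the square of `∫ √(dμ dν)`. -/
def AffinityGE {α : Type*} [MeasurableSpace α] (μ ν : Measure α) (c : ℝ≥0∞) : Prop :=
  ∀ ⦃f g : α → ℝ≥0∞⦄, Measurable f → Measurable g → (∀ x, 1 ≤ f x * g x) →
    c ≤ (∫⁻ x, f x ∂μ) * ∫⁻ x, g x ∂ν

namespace AffinityGE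

variable {α β : Type*} [MeasurableSpace α] [MeasurableSpace β]

/-- Cauchy–Schwarz applied to `√f` and `√g`. -/
theorem refl (μ : Measure α) [IsProbabilityMeasure μ] : AffinityGE μ μ 1 := by
  intro f g hf hg h
  have key := ENNReal.lintegral_mul_le_Lp_mul_Lq μ Real.HolderConjugate.two_two
    (hf.pow_const (1 / 2 : ℝ)).aemeasurable (hg.pow_const (1 / 2 : ℝ)).aemeasurable
  have h1 : (1 : ℝ≥0∞) ≤ ∫⁻ x, ((fun x => f x ^ (1 / 2 : ℝ)) * fun x => g x ^ (1 / 2 : ℝ)) x ∂μ := by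
    calc (1 : ℝ≥0∞) = ∫⁻ _, 1 ∂μ := by simp
      _ ≤ _ := by
        refine lintegral_mono fun x => ?_
        simp only [Pi.mul_apply]
        rw [← ENNReal.mul_rpow_of_nonneg _ _ (by norm_num)]
        exact ENNReal.one_le_rpow (h x) (by norm_num)
  have h2 := h1.trans key
  simp only [← ENNReal.rpow_mul] at h2
  norm_num at h2
  rw [← ENNReal.mul_rpow_of_nonneg _ _ (by norm_num)] at h2
  by_contra hlt
  push Not at hlt
  exact absurd h2 (not_le.2 (ENNReal.rpow_lt_one hlt (by norm_num)))

theorem mul_le {μ ν : Measure α} {c e : ℝ≥0∞} (h : AffinityGE μ ν c) (he0 : e ≠ 0) (he : e ≠ ∞)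
    {f g : α → ℝ≥0∞} (hf : Measurable f) (hg : Measurable g) (hfg : ∀ x, e ≤ f x * g x) :
    c * e ≤ (∫⁻ x, f x ∂μ) * ∫⁻ x, g x ∂ν := by
  have := h hf (hg.const_mul e⁻¹) fun x => by
    rw [mul_left_comm, ← ENNReal.inv_mul_cancel he0 he]
    gcongr
    exact hfg x
  rw [lintegral_const_mul _ hg, mul_left_comm] at this
  calc c * e ≤ e⁻¹ * ((∫⁻ x, f x ∂μ) * ∫⁻ x, g x ∂ν) * e := by gcongr
    _ = _ := by rw [mul_right_comm, ENNReal.inv_mul_cancel he0 he, one_mul]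

theorem map {μ ν : Measure α} {c : ℝ≥0∞} (h : AffinityGE μ ν c) {φ : α → β} (hφ : Measurable φ) :
    AffinityGE (μ.map φ) (ν.map φ) c := by
  intro f g hf hg hfg
  rw [lintegral_map hf hφ, lintegral_map hg hφ]
  exact h (hf.comp hφ) (hg.comp hφ) fun x => hfg _

/-- The inner integrals of `f` and `g` have product at least `e` at every point, so they serve,
after the rescaling in `mul_le`, as test functions for the first marginals. -/
theorem compProd {μ ν : Measure α} [SFinite μ] [SFinite ν] {κ η : Kernel α β} [IsSFiniteKernel κ]
    [IsSFiniteKernel η] {c e : ℝ≥0∞} (h : AffinityGE μ ν c) (he0 : e ≠ 0) (he : e ≠ ∞)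
    (hκ : ∀ x, AffinityGE (κ x) (η x) e) : AffinityGE (μ ⊗ₘ κ) (ν ⊗ₘ η) (c * e) := by
  intro f g hf hg hfg
  rw [Measure.lintegral_compProd hf, Measure.lintegral_compProd hg]
  exact h.mul_le he0 he hf.lintegral_kernel_prod_right' hg.lintegral_kernel_prod_right' fun x =>
    hκ x (hf.comp measurable_prodMk_left) (hg.comp measurable_prodMk_left) fun y => hfg _

/-- The sum of the error probabilities of any test is bounded below by the affinity. -/
theorem le_four_mul_add {μ ν : Measure α} [IsProbabilityMeasure μ] [IsProbabilityMeasure ν]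
    {c : ℝ≥0∞} (h : AffinityGE μ ν c) {f g : α → ℝ≥0∞} (hf : Measurable f) (hg : Measurable g)
    (hfg : ∀ x, 1 ≤ f x + g x) : c ≤ 4 * (∫⁻ x, f x ∂μ + ∫⁻ x, g x ∂ν) := by
  set s := ∫⁻ x, f x ∂μ + ∫⁻ x, g x ∂ν with hs
  have key : ∀ e : ℝ≥0, s < e → c ≤ 4 * (e : ℝ≥0∞) := by
    intro e he
    have he0 : (e : ℝ≥0∞) ≠ 0 := (bot_lt_of_lt he).ne'
    let f' : α → ℝ≥0∞ := fun x => min (f x) 1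
    let g' : α → ℝ≥0∞ := fun x => min (g x) 1
    have hf' : Measurable f' := hf.min measurable_const
    have hg' : Measurable g' := hg.min measurable_const
    -- The product of these test functions is `(f' + g')² + f'g'(e + e⁻¹ - 2) ≥ 1`. Truncation at 1
    -- bounds the cross integrals by 1, so the weights `e` and `e⁻¹` make the two factors at most
    -- `2e` and `2`.
    have h1 := h (f := fun x => f' x + e * g' x) (g := fun x => f' x + (e : ℝ≥0∞)⁻¹ * g' x)
      (hf'.add (hg'.const_mul _)) (hf'.add (hg'.const_mul _)) fun x => by
        have h1 : 1 ≤ f' x + g' x := by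
          simp only [f', g']
          rcases le_total (f x) 1 with h1 | h1 <;> rcases le_total (g x) 1 with h2 | h2 <;>
            simp [h1, h2, hfg x]
        have hfx : f' x ≠ ∞ := ne_top_of_le_ne_top ENNReal.one_ne_top (min_le_right _ _)
        have hgx : g' x ≠ ∞ := ne_top_of_le_ne_top ENNReal.one_ne_top (min_le_right _ _)
        generalize f' x = u at *
        generalize g' x = w at *
        lift u to ℝ≥0 using hfx
        lift w to ℝ≥0 using hgx
        have he0' : e ≠ 0 := by simpa using he0
        rw [← ENNReal.coe_inv he0']
        norm_cast at *
        have hpos : 0 < (e : ℝ) := by positivity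
        have h1' : (1 : ℝ) ≤ u + w := by exact_mod_cast h1
        rw [← NNReal.coe_le_coe]
        push_cast
        have h3 : (2 : ℝ) ≤ e + (e : ℝ)⁻¹ := by
          have : (e : ℝ) * (e : ℝ)⁻¹ = 1 := mul_inv_cancel₀ hpos.ne'
          nlinarith [sq_nonneg ((e : ℝ) - (e : ℝ)⁻¹), inv_pos.2 hpos]
        have h4 : ((u : ℝ) + e * w) * (u + (e : ℝ)⁻¹ * w)
            = (u + w) ^ 2 + u * w * (e + (e : ℝ)⁻¹ - 2) := by
          field_simp
          ring
        rw [h4]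
        have : 0 ≤ (u : ℝ) * w * (e + (e : ℝ)⁻¹ - 2) :=
          mul_nonneg (by positivity) (by linarith)
        nlinarith
    rw [lintegral_add_left hf', lintegral_add_left hf', lintegral_const_mul _ hg',
      lintegral_const_mul _ hg'] at h1
    have a1 : ∫⁻ x, f' x ∂μ ≤ e :=
      (lintegral_mono fun x => min_le_left _ _).trans (le_self_add.trans he.le)
    have a2 : ∫⁻ x, g' x ∂ν ≤ e :=
      (lintegral_mono fun x => min_le_left _ _).trans (le_add_self.trans he.le)
    have a3 : ∫⁻ x, g' x ∂μ ≤ 1 :=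
      (lintegral_mono fun x => min_le_right _ _).trans (by simp)
    have a4 : ∫⁻ x, f' x ∂ν ≤ 1 :=
      (lintegral_mono fun x => min_le_right _ _).trans (by simp)
    calc c ≤ _ := h1
      _ ≤ (e + e * 1) * (1 + (e : ℝ≥0∞)⁻¹ * e) := by gcongr
      _ = 4 * e := by
        rw [ENNReal.inv_mul_cancel he0 ENNReal.coe_ne_top]
        ring
  have h4 : c / 4 ≤ s := by
    refine ENNReal.le_of_forall_pos_le_add fun ε hε hs' => ?_
    have : s < (s.toNNReal + ε : ℝ≥0) := by
      rw [ENNReal.coe_add, ENNReal.coe_toNNReal hs'.ne]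
      exact ENNReal.lt_add_right hs'.ne (by simpa using hε.ne')
    have := key _ this
    rw [ENNReal.coe_add, ENNReal.coe_toNNReal hs'.ne] at this
    exact ENNReal.div_le_of_le_mul' this
  rw [mul_comm]
  exact (ENNReal.div_le_iff_le_mul (by simp) (by simp)).1 h4

end AffinityGE

/-! ### Affinity of Gaussians with equal variance -/

theorem gaussianPDFReal_eq_exp_mul_midpoint (m₁ m₂ : ℝ) {v : ℝ≥0} (hv : v ≠ 0) (x : ℝ) :
    gaussianPDFReal m₁ v x = Real.exp (-((m₁ - m₂) ^ 2 / (8 * v))) *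
      Real.exp ((m₁ - m₂) * (x - (m₁ + m₂) / 2) / (2 * v)) *
        gaussianPDFReal ((m₁ + m₂) / 2) v x := by
  have hv' : (v : ℝ) ≠ 0 := by exact_mod_cast hv
  simp only [gaussianPDFReal]
  rw [mul_left_comm, ← Real.exp_add, ← Real.exp_add]
  congr 2
  field_simp
  ring

/-- Relative to the Gaussian at the midpoint, the two densities are `k e^ℓ` and `k e^{-ℓ}`. The
opposite tilts cancel in the product of test functions, leaving `k² = exp(-(m₁ - m₂)²/(4v))`. For `v
= 0` the hypothesis forces equal means. -/
theorem affinityGE_gaussianReal (m₁ m₂ : ℝ) (v : ℝ≥0) {r : ℝ} (hr : 0 ≤ r)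
    (h : (m₁ - m₂) ^ 2 ≤ 4 * v * r) :
    AffinityGE (gaussianReal m₁ v) (gaussianReal m₂ v) (ENNReal.ofReal (Real.exp (-r))) := by
  rcases eq_or_ne v 0 with rfl | hv
  · have : m₁ = m₂ := by
      have : (m₁ - m₂) ^ 2 ≤ 0 := by simpa using h
      exact sub_eq_zero.1 (pow_eq_zero_iff two_ne_zero |>.1 (le_antisymm this (sq_nonneg _)))
    subst this
    intro f g hf hg hfg
    refine le_trans ?_ (AffinityGE.refl _ hf hg hfg)
    simpa using hr
  have hv0 : (0 : ℝ) < v := by positivity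
  intro f g hf hg hfg
  set m := (m₁ + m₂) / 2 with hm
  set ℓ : ℝ → ℝ := fun x => (m₁ - m₂) * (x - m) / (2 * v) with hℓ
  have hℓm : Measurable ℓ := by fun_prop
  set k := ENNReal.ofReal (Real.exp (-((m₁ - m₂) ^ 2 / (8 * v)))) with hk
  have e1 : ∀ x, gaussianPDF m₁ v x = k * (ENNReal.ofReal (Real.exp (ℓ x)) * gaussianPDF m v x) := by
    intro x
    simp only [gaussianPDF, hk]
    rw [gaussianPDFReal_eq_exp_mul_midpoint m₁ m₂ hv, ENNReal.ofReal_mul (by positivity),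
      ENNReal.ofReal_mul (by positivity), mul_assoc]
  have e2 : ∀ x, gaussianPDF m₂ v x = k * (ENNReal.ofReal (Real.exp (-ℓ x)) * gaussianPDF m v x) := by
    intro x
    simp only [gaussianPDF, hk]
    rw [gaussianPDFReal_eq_exp_mul_midpoint m₂ m₁ hv, ENNReal.ofReal_mul (by positivity),
      ENNReal.ofReal_mul (by positivity), mul_assoc, add_comm m₂ m₁]
    have h1 : (m₂ - m₁) ^ 2 = (m₁ - m₂) ^ 2 := by ring
    have h2 : (m₂ - m₁) * (x - m) / (2 * v) = -ℓ x := by simp only [hℓ]; ring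
    rw [h1, ← hm, h2]
  have i1 : ∫⁻ x, f x ∂gaussianReal m₁ v
      = k * ∫⁻ x, ENNReal.ofReal (Real.exp (ℓ x)) * f x ∂gaussianReal m v := by
    rw [gaussianReal_of_var_ne_zero _ hv, gaussianReal_of_var_ne_zero _ hv,
      lintegral_withDensity_eq_lintegral_mul _ (measurable_gaussianPDF _ _) hf,
      lintegral_withDensity_eq_lintegral_mul _ (measurable_gaussianPDF _ _) (by fun_prop),
      ← lintegral_const_mul _ (by fun_prop)]
    refine lintegral_congr fun x => ?_
    simp only [Pi.mul_apply, e1]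
    ring
  have i2 : ∫⁻ x, g x ∂gaussianReal m₂ v
      = k * ∫⁻ x, ENNReal.ofReal (Real.exp (-ℓ x)) * g x ∂gaussianReal m v := by
    rw [gaussianReal_of_var_ne_zero _ hv, gaussianReal_of_var_ne_zero _ hv,
      lintegral_withDensity_eq_lintegral_mul _ (measurable_gaussianPDF _ _) hg,
      lintegral_withDensity_eq_lintegral_mul _ (measurable_gaussianPDF _ _) (by fun_prop),
      ← lintegral_const_mul _ (by fun_prop)]
    refine lintegral_congr fun x => ?_
    simp only [Pi.mul_apply, e2]
    ring
  have hone := AffinityGE.refl (gaussianReal m v)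
    (f := fun x => ENNReal.ofReal (Real.exp (ℓ x)) * f x)
    (g := fun x => ENNReal.ofReal (Real.exp (-ℓ x)) * g x) (by fun_prop) (by fun_prop) fun x => by
      rw [mul_mul_mul_comm, ← ENNReal.ofReal_mul (by positivity), ← Real.exp_add]
      simpa using hfg x
  rw [i1, i2, mul_mul_mul_comm]
  calc ENNReal.ofReal (Real.exp (-r)) ≤ k * k * 1 := by
        rw [mul_one, hk, ← ENNReal.ofReal_mul (by positivity), ← Real.exp_add]
        refine ENNReal.ofReal_le_ofReal (Real.exp_le_exp.2 ?_)
        have : (m₁ - m₂) ^ 2 / (8 * v) ≤ r / 2 := by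
          rw [div_le_iff₀ (by positivity)]
          linarith
        linarith
    _ ≤ _ := by gcongr

/-- Two product measures that differ in one factor have at least the affinity of these factors. -/
theorem AffinityGE.pi_of_eq_off {d : ℕ} {μ ν : Fin d → Measure ℝ} [∀ j, IsProbabilityMeasure (μ j)]
    [∀ j, IsProbabilityMeasure (ν j)] (k : Fin d) (hne : ∀ j, j ≠ k → μ j = ν j) {c : ℝ≥0∞}
    (h : AffinityGE (μ k) (ν k) c) : AffinityGE (Measure.pi μ) (Measure.pi ν) c := by
  cases d with
  | zero => exact k.elim0
  | succ n =>
    have hrest : (fun j => μ (k.succAbove j)) = fun j => ν (k.succAbove j) :=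
      funext fun j => hne _ (Fin.succAbove_ne k j)
    rw [← ((measurePreserving_piFinSuccAbove μ k).symm).map_eq,
      ← ((measurePreserving_piFinSuccAbove ν k).symm).map_eq, hrest]
    refine AffinityGE.map ?_ (MeasurableEquiv.measurable _)
    -- The common remaining factors become a constant kernel, of affinity 1 with itself.
    rw [← Measure.compProd_const, ← Measure.compProd_const, ← mul_one c]
    refine h.compProd one_ne_zero ENNReal.one_ne_top fun x => ?_
    simpa using AffinityGE.refl (Measure.pi fun j => ν (k.succAbove j))

instance {d : ℕ} (θ : Vec d) (v : ℝ≥0) : IsProbabilityMeasure (gaussianVec θ v) :=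
  Measure.isProbabilityMeasure_map (by fun_prop)

instance {d T : ℕ} (σ2 : ModelIdx T → ℝ≥0) (θ : ModelIdx T → Vec d) :
    IsProbabilityMeasure (tableRow σ2 θ) := by
  unfold tableRow
  infer_instance

theorem affinityGE_gaussianVec {d : ℕ} {θ θ' : Vec d} (v : ℝ≥0) (k : Fin d)
    (hne : ∀ j, j ≠ k → θ j = θ' j) {r : ℝ} (hr : 0 ≤ r) (hk : (θ k - θ' k) ^ 2 ≤ 4 * v * r) :
    AffinityGE (gaussianVec θ v) (gaussianVec θ' v) (ENNReal.ofReal (Real.exp (-r))) := by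
  refine AffinityGE.map ?_ (by fun_prop)
  exact AffinityGE.pi_of_eq_off k (fun j hj => by rw [hne j hj]) (affinityGE_gaussianReal _ _ v hr hk)

/-! ### Affinity of adaptively collected histories -/

theorem measurable_extendHistory {d T n : ℕ} :
    Measurable (extendHistory : History d T n × (ModelIdx T × (ModelIdx T → Vec d)) → _) := by
  refine measurable_pi_iff.2 fun i => ?_
  have hz : Measurable fun p : ModelIdx T × (ModelIdx T → Vec d) => p.2 p.1 :=
    measurable_from_prod_countable_right fun a => measurable_pi_apply a
  refine Fin.lastCases ?_ (fun j => ?_) i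
  · simp only [extendHistory, Fin.snoc_last]
    exact (measurable_fst.comp measurable_snd).prodMk (hz.comp measurable_snd)
  · simp only [extendHistory, Fin.snoc_castSucc]
    exact (measurable_pi_apply j).comp measurable_fst

instance {N d T : ℕ} (A : Algorithm N d T) (σ2 : ModelIdx T → ℝ≥0) (θ : ModelIdx T → Vec d)
    (n : ℕ) : IsProbabilityMeasure (historyLaw A σ2 θ n) := by
  induction n with
  | zero => unfold historyLaw; infer_instance
  | succ n ih =>
    have := A.policy_markov n
    unfold historyLaw
    exact Measure.isProbabilityMeasure_map measurable_extendHistory.aemeasurable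

theorem lintegral_historyLaw_succ {N d T : ℕ} (A : Algorithm N d T) (σ2 : ModelIdx T → ℝ≥0)
    (θ : ModelIdx T → Vec d) (n : ℕ) {f : History d T (n + 1) → ℝ≥0∞} (hf : Measurable f) :
    ∫⁻ h, f h ∂historyLaw A σ2 θ (n + 1) = ∫⁻ h, ∫⁻ a, ∫⁻ z, f (extendHistory (h, a, z))
      ∂tableRow σ2 θ ∂A.policy n h ∂historyLaw A σ2 θ n := by
  have := A.policy_markov n
  have hm : Measurable fun p : History d T n × (ModelIdx T × (ModelIdx T → Vec d)) =>
      f (extendHistory p) := hf.comp measurable_extendHistory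
  rw [historyLaw, lintegral_map hf measurable_extendHistory, Measure.lintegral_compProd hm]
  refine lintegral_congr fun h => ?_
  have hmh : Measurable fun p : ModelIdx T × (ModelIdx T → Vec d) => f (extendHistory (h, p)) :=
    hm.comp measurable_prodMk_left
  rw [Kernel.prod_apply, lintegral_prod _ hmh.aemeasurable]
  simp

/-- If every sample has affinity at least `c`, whichever model it is taken from, then `n`
adaptively collected samples have affinity at least `c ^ n`. -/
theorem affinityGE_historyLaw {N d T : ℕ} (A : Algorithm N d T) (σ2 : ModelIdx T → ℝ≥0)
    {θ θ' : ModelIdx T → Vec d} {c : ℝ≥0∞} (hc0 : c ≠ 0) (hc : c ≠ ∞)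
    (h : ∀ t, AffinityGE (gaussianVec (θ t) (σ2 t)) (gaussianVec (θ' t) (σ2 t)) c) (n : ℕ) :
    AffinityGE (historyLaw A σ2 θ n) (historyLaw A σ2 θ' n) (c ^ n) := by
  induction n with
  | zero => simpa [historyLaw] using AffinityGE.refl (historyLaw A σ2 θ 0)
  | succ n ih =>
    intro f g hf hg hfg
    have := A.policy_markov n
    rw [lintegral_historyLaw_succ A σ2 θ n hf, lintegral_historyLaw_succ A σ2 θ' n hg, pow_succ]
    have hmeas : ∀ (θ : ModelIdx T → Vec d) {f : History d T (n + 1) → ℝ≥0∞}, Measurable f →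
        Measurable fun p : History d T n × ModelIdx T =>
          ∫⁻ z, f (extendHistory (p.1, p.2, z)) ∂tableRow σ2 θ := fun θ f hf =>
      Measurable.lintegral_prod_right'
        (f := fun p : (History d T n × ModelIdx T) × (ModelIdx T → Vec d) =>
          f (extendHistory (p.1.1, p.1.2, p.2)))
        (hf.comp (measurable_extendHistory.comp (by fun_prop)))
    refine ih.mul_le hc0 hc (Measurable.lintegral_kernel_prod_right' (hmeas θ hf))
      (Measurable.lintegral_kernel_prod_right' (hmeas θ' hg)) fun h' => ?_
    rw [← one_mul c]
    refine (AffinityGE.refl (A.policy n h')).mul_le hc0 hc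
      ((hmeas θ hf).comp measurable_prodMk_left) ((hmeas θ' hg).comp measurable_prodMk_left)
      fun a => ?_
    have hsnoc : Measurable fun s : Vec d =>
        (Fin.snoc (α := fun _ => ModelIdx T × Vec d) h' (a, s) : History d T (n + 1)) := by
      refine measurable_pi_iff.2 fun i => ?_
      refine Fin.lastCases ?_ (fun j => ?_) i
      · simpa using measurable_prodMk_left
      · simp
    -- Only the chosen column is seen, so the row integral reduces to one Gaussian; comparing whole
    -- rows would cost a factor for each of the `T + 1` columns.
    have heval : ∀ (θ : ModelIdx T → Vec d) {f : History d T (n + 1) → ℝ≥0∞}, Measurable f →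
        ∫⁻ z, f (extendHistory (h', a, z)) ∂tableRow σ2 θ
          = ∫⁻ s, f (Fin.snoc (α := fun _ => ModelIdx T × Vec d) h' (a, s))
              ∂gaussianVec (θ a) (σ2 a) := fun θ f hf =>
      (measurePreserving_eval (fun t => gaussianVec (θ t) (σ2 t)) a).lintegral_comp
        (hf.comp hsnoc)
    rw [heval θ hf, heval θ' hg]
    exact h a (hf.comp hsnoc) (hg.comp hsnoc) fun s => hfg _

/-! ### Two-point bound and Assouad's lemma -/

/-- The joint law of the collected history and the estimate. -/
noncomputable def outputLaw {N d T : ℕ} (A : Algorithm N d T) (σ2 : ModelIdx T → ℝ≥0)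
    (θ : ModelIdx T → Vec d) : Measure (History d T N × Vec d) :=
  historyLaw A σ2 θ N ⊗ₘ A.estimator

instance {N d T : ℕ} (A : Algorithm N d T) (σ2 : ModelIdx T → ℝ≥0) (θ : ModelIdx T → Vec d) :
    IsProbabilityMeasure (outputLaw A σ2 θ) := by
  have := A.estimator_markov
  unfold outputLaw
  infer_instance

theorem risk_eq_lintegral_outputLaw {N d T : ℕ} (A : Algorithm N d T) (σ2 : ModelIdx T → ℝ≥0)
    (θ : ModelIdx T → Vec d) :
    risk A σ2 θ = ∫⁻ p, ENNReal.ofReal (‖p.2 - θ 0‖ ^ 2) ∂outputLaw A σ2 θ := by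
  have := A.estimator_markov
  rw [outputLaw, Measure.lintegral_compProd (by fun_prop), risk]

theorem sum_lintegral_sq_le_risk {N d T : ℕ} (A : Algorithm N d T) (σ2 : ModelIdx T → ℝ≥0)
    (θ : ModelIdx T → Vec d) (K : Finset (Fin d)) :
    ∑ k ∈ K, ∫⁻ p, ENNReal.ofReal ((p.2 k - θ 0 k) ^ 2) ∂outputLaw A σ2 θ ≤ risk A σ2 θ := by
  rw [risk_eq_lintegral_outputLaw, ← lintegral_finsetSum _ fun k _ => by fun_prop]
  refine lintegral_mono fun p => ?_
  simp only
  rw [← ENNReal.ofReal_sum_of_nonneg fun k _ => sq_nonneg _]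
  refine ENNReal.ofReal_le_ofReal ?_
  rw [EuclideanSpace.real_norm_sq_eq]
  simp only [PiLp.sub_apply]
  exact Finset.sum_le_univ_sum_of_nonneg fun k => sq_nonneg _

/-- The two parameters are too close for `N` samples to tell them apart: they differ in the
coordinate `k` only, by at most two standard deviations of an average of `N` samples. -/
def Indistinguishable {d T : ℕ} (N : ℕ) (σ2 : ModelIdx T → ℝ≥0) (k : Fin d)
    (θ θ' : ModelIdx T → Vec d) : Prop :=
  ∀ t, (∀ j, j ≠ k → θ t j = θ' t j) ∧ N * (θ t k - θ' t k) ^ 2 ≤ 4 * σ2 t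

theorem Indistinguishable.affinityGE_outputLaw {N d T : ℕ} (hN : 1 ≤ N) (A : Algorithm N d T)
    {σ2 : ModelIdx T → ℝ≥0} {k : Fin d} {θ θ' : ModelIdx T → Vec d}
    (h : Indistinguishable N σ2 k θ θ') :
    AffinityGE (outputLaw A σ2 θ) (outputLaw A σ2 θ') (ENNReal.ofReal (Real.exp (-1))) := by
  have := A.estimator_markov
  have hN0 : (0 : ℝ) < N := by exact_mod_cast hN
  have hpow : ENNReal.ofReal (Real.exp (-(1 / N : ℝ))) ^ N = ENNReal.ofReal (Real.exp (-1)) := by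
    rw [← ENNReal.ofReal_pow (by positivity), ← Real.exp_nat_mul]
    congr 2
    field_simp
  rw [← hpow, ← mul_one (_ ^ N)]
  refine (affinityGE_historyLaw A σ2 (by simpa using Real.exp_pos _) ENNReal.ofReal_ne_top
    (fun t => ?_) N).compProd one_ne_zero ENNReal.one_ne_top fun x => AffinityGE.refl _
  refine affinityGE_gaussianVec _ k (h t).1 (by positivity) ?_
  rw [mul_one_div, le_div_iff₀ hN0, mul_comm]
  exact (h t).2

/-- Two indistinguishable parameters whose targets have `k`-th coordinates `2 * a` apart: no
algorithm estimates both coordinates well. -/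
theorem Indistinguishable.le_lintegral_sq_add {N d T : ℕ} (hN : 1 ≤ N) (A : Algorithm N d T)
    {σ2 : ModelIdx T → ℝ≥0} {k : Fin d} {θ θ' : ModelIdx T → Vec d}
    (h : Indistinguishable N σ2 k θ θ') {a : ℝ} (ha : 0 < a)
    (hdist : (θ 0 k - θ' 0 k) ^ 2 = (2 * a) ^ 2) :
    ENNReal.ofReal (Real.exp (-1) * a ^ 2 / 2) ≤
      ∫⁻ p, ENNReal.ofReal ((p.2 k - θ 0 k) ^ 2) ∂outputLaw A σ2 θ +
        ∫⁻ p, ENNReal.ofReal ((p.2 k - θ' 0 k) ^ 2) ∂outputLaw A σ2 θ' := by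
  -- The normalization `1/(2a²)` comes from `u² + w² ≥ (u - w)²/2 = 2a²` for the two errors `u`,
  -- `w`.
  have key := (h.affinityGE_outputLaw hN A).le_four_mul_add
    (f := fun p => ENNReal.ofReal (1 / (2 * a ^ 2)) * ENNReal.ofReal ((p.2 k - θ 0 k) ^ 2))
    (g := fun p => ENNReal.ofReal (1 / (2 * a ^ 2)) * ENNReal.ofReal ((p.2 k - θ' 0 k) ^ 2))
    (by fun_prop) (by fun_prop) fun p => by
      rw [← mul_add, ← ENNReal.ofReal_add (by positivity) (by positivity),
        ← ENNReal.ofReal_mul (by positivity), ENNReal.one_le_ofReal, one_div_mul_eq_div,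
        le_div_iff₀ (by positivity)]
      nlinarith [sq_nonneg (p.2 k - θ 0 k + (p.2 k - θ' 0 k))]
  rw [lintegral_const_mul _ (by fun_prop), lintegral_const_mul _ (by fun_prop), ← mul_add] at key
  set S := ∫⁻ p, ENNReal.ofReal ((p.2 k - θ 0 k) ^ 2) ∂outputLaw A σ2 θ +
        ∫⁻ p, ENNReal.ofReal ((p.2 k - θ' 0 k) ^ 2) ∂outputLaw A σ2 θ'
  calc ENNReal.ofReal (Real.exp (-1) * a ^ 2 / 2)
      = ENNReal.ofReal (a ^ 2 / 2) * ENNReal.ofReal (Real.exp (-1)) := by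
        rw [← ENNReal.ofReal_mul (by positivity)]
        congr 1
        ring
    _ ≤ ENNReal.ofReal (a ^ 2 / 2) * (4 * (ENNReal.ofReal (1 / (2 * a ^ 2)) * S)) := by gcongr
    _ = (ENNReal.ofReal (a ^ 2 / 2) * (ENNReal.ofReal 4 * ENNReal.ofReal (1 / (2 * a ^ 2)))) * S := by
        rw [show ENNReal.ofReal 4 = 4 by norm_num]
        ring
    _ = S := by
        rw [← ENNReal.ofReal_mul (by positivity), ← ENNReal.ofReal_mul (by positivity)]
        have : a ^ 2 / 2 * (4 * (1 / (2 * a ^ 2))) = 1 := by field_simp; norm_num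
        rw [this, ENNReal.ofReal_one, one_mul]

/-- Flip the sign in the coordinate `k`. -/
def flipAt {d : ℕ} (k : Fin d) (v : Fin d → Bool) : Fin d → Bool :=
  Function.update v k (!v k)

theorem flipAt_involutive {d : ℕ} (k : Fin d) : Function.Involutive (flipAt k) := by
  intro v
  simp [flipAt]

/-- Assouad's bound for a hypercube of parameters, with the coordinates in `K` as directions. -/
theorem le_minimaxRisk_of_hypercube {N d T : ℕ} (hN : 1 ≤ N) {σ2 : ModelIdx T → ℝ≥0}
    {Ψ : Set (ModelIdx T → Vec d)} (θ : (Fin d → Bool) → ModelIdx T → Vec d) (hΨ : ∀ v, θ v ∈ Ψ)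
    (K : Finset (Fin d)) {a : ℝ} (ha : 0 < a)
    (hdist : ∀ v, ∀ k ∈ K, (θ v 0 k - θ (flipAt k v) 0 k) ^ 2 = (2 * a) ^ 2)
    (hind : ∀ v, ∀ k ∈ K, Indistinguishable N σ2 k (θ v) (θ (flipAt k v))) :
    ENNReal.ofReal (Real.exp (-1) / 4 * (K.card * a ^ 2)) ≤ minimaxRisk N Ψ σ2 := by
  refine le_iInf fun A => ?_
  set S := ⨆ θ ∈ Ψ, risk A σ2 θ with hS
  set R : (Fin d → Bool) → Fin d → ℝ≥0∞ := fun v k =>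
    ∫⁻ p, ENNReal.ofReal ((p.2 k - θ v 0 k) ^ 2) ∂outputLaw A σ2 (θ v) with hR
  set M : ℝ≥0∞ := (Fintype.card (Fin d → Bool) : ℝ≥0∞) with hM
  have hM0 : M ≠ 0 := by simp [hM]
  have hMt : M ≠ ∞ := by simp [hM]
  have upper : ∑ v, ∑ k ∈ K, R v k ≤ M * S := by
    calc ∑ v, ∑ k ∈ K, R v k ≤ ∑ _v : Fin d → Bool, S :=
          Finset.sum_le_sum fun v _ => (sum_lintegral_sq_le_risk A σ2 (θ v) K).trans
            (le_iSup₂ (f := fun θ (_ : θ ∈ Ψ) => risk A σ2 θ) (θ v) (hΨ v))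
      _ = M * S := by rw [Finset.sum_const, nsmul_eq_mul, Finset.card_univ]
  have lower : M * (K.card * ENNReal.ofReal (Real.exp (-1) * a ^ 2 / 2)) ≤
      2 * ∑ v, ∑ k ∈ K, R v k := by
    -- Each flip permutes the sign patterns, so pairing every vertex with its neighbour counts each
    -- error twice.
    have hflip : ∑ v, ∑ k ∈ K, R (flipAt k v) k = ∑ v, ∑ k ∈ K, R v k := by
      rw [Finset.sum_comm, Finset.sum_comm (s := Finset.univ) (t := K)]
      refine Finset.sum_congr rfl fun k _ => ?_
      exact Equiv.sum_comp (flipAt_involutive k).toPerm fun v => R v k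
    calc M * (K.card * ENNReal.ofReal (Real.exp (-1) * a ^ 2 / 2))
        = ∑ _v : Fin d → Bool, ∑ _k ∈ K, ENNReal.ofReal (Real.exp (-1) * a ^ 2 / 2) := by
          simp only [Finset.sum_const, nsmul_eq_mul, Finset.card_univ, hM]
      _ ≤ ∑ v, ∑ k ∈ K, (R v k + R (flipAt k v) k) :=
          Finset.sum_le_sum fun v _ => Finset.sum_le_sum fun k hk =>
            (hind v k hk).le_lintegral_sq_add hN A ha (hdist v k hk)
      _ = 2 * ∑ v, ∑ k ∈ K, R v k := by
          simp only [Finset.sum_add_distrib]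
          rw [hflip, two_mul]
  have hfin : K.card * ENNReal.ofReal (Real.exp (-1) * a ^ 2 / 2) ≤ 2 * S := by
    rw [← ENNReal.mul_le_mul_iff_right hM0 hMt]
    calc _ ≤ 2 * ∑ v, ∑ k ∈ K, R v k := lower
      _ ≤ 2 * (M * S) := by gcongr
      _ = _ := by ring
  rw [← ENNReal.mul_le_mul_iff_right (a := 2) (by simp) (by simp)]
  refine le_trans (le_of_eq ?_) hfin
  rw [← ENNReal.ofReal_ofNat, ← ENNReal.ofReal_mul (by simp), ← ENNReal.ofReal_natCast,
    ← ENNReal.ofReal_mul (by positivity)]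
  congr 1
  ring

/-! ### The two cubes of hard parameters -/

/-- The vertex with sign pattern `v` of the cube `[-a, a]^K`. -/
noncomputable def cubeVertex {d : ℕ} (K : Finset (Fin d)) (a : ℝ) (v : Fin d → Bool) : Vec d :=
  WithLp.toLp 2 fun j => if j ∈ K then (if v j then a else -a) else 0

theorem cubeVertex_sq {d : ℕ} {K : Finset (Fin d)} (a : ℝ) (v : Fin d → Bool) (j : Fin d) :
    cubeVertex K a v j ^ 2 = if j ∈ K then a ^ 2 else 0 := by
  simp only [cubeVertex]
  split_ifs <;> simp

theorem norm_cubeVertex_sq {d : ℕ} (K : Finset (Fin d)) (a : ℝ) (v : Fin d → Bool) :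
    ‖cubeVertex K a v‖ ^ 2 = K.card * a ^ 2 := by
  simp [EuclideanSpace.real_norm_sq_eq, cubeVertex_sq]

theorem cubeVertex_flipAt_of_ne {d : ℕ} (K : Finset (Fin d)) (a : ℝ) (v : Fin d → Bool)
    {j k : Fin d} (h : j ≠ k) : cubeVertex K a (flipAt k v) j = cubeVertex K a v j := by
  simp [cubeVertex, flipAt, h]

theorem cubeVertex_sub_flipAt_sq {d : ℕ} {K : Finset (Fin d)} (a : ℝ) (v : Fin d → Bool)
    {k : Fin d} (hk : k ∈ K) :
    (cubeVertex K a v k - cubeVertex K a (flipAt k v) k) ^ 2 = (2 * a) ^ 2 := by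
  cases h : v k <;> simp [cubeVertex, flipAt, hk, h] <;> ring

/-- A point on the axis orthogonal to the cube is at the same distance from all vertices. -/
theorem norm_single_sub_cubeVertex_sq {n : ℕ} (a b : ℝ) (v : Fin (n + 1) → Bool) :
    ‖EuclideanSpace.single (Fin.last n) b - cubeVertex (Finset.univ.erase (Fin.last n)) a v‖ ^ 2
      = b ^ 2 + n * a ^ 2 := by
  have horth : inner ℝ (EuclideanSpace.single (Fin.last n) b)
      (cubeVertex (Finset.univ.erase (Fin.last n)) a v) = 0 := by
    rw [EuclideanSpace.inner_single_left]
    simp [cubeVertex]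
  rw [norm_sub_sq_real, horth, norm_cubeVertex_sq]
  simp

theorem fullyLocalized_subset_singleLocalized {d T : ℕ} (q : ModelIdx T → ℝ) {t : ModelIdx T}
    (ht : t ≠ 0) : fullyLocalized d q ⊆ singleLocalized d T (q t) := by
  intro θ hθ
  obtain ⟨ζ, hζ⟩ := Set.mem_iUnion.1 hθ
  obtain ⟨s, rfl⟩ := Fin.exists_succ_eq.2 ht
  exact ⟨ζ.symm s, by simpa using hζ (ζ.symm s)⟩

theorem minimaxRisk_mono {N d T : ℕ} {Ψ Ψ' : Set (ModelIdx T → Vec d)} (h : Ψ ⊆ Ψ')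
    (σ2 : ModelIdx T → ℝ≥0) : minimaxRisk N Ψ σ2 ≤ minimaxRisk N Ψ' σ2 :=
  iInf_mono fun _ => biSup_mono h

/-- If all sources whose noise variance is below `s` are far from the target, then no algorithm
beats the rate `d * s / N` on the fully localized set, up to a constant. -/
theorem le_minimaxRisk_fullyLocalized {N d T : ℕ} (hN : 1 ≤ N) (hd : 2 ≤ d)
    {σ2 : ModelIdx T → ℝ≥0} {q : ModelIdx T → ℝ} (hq : q 0 = 0) {s : ℝ} (hs : 0 < s)
    (h0 : s ≤ σ2 0) (hfar : ∀ t, (σ2 t : ℝ) < s → d * s / N ≤ q t ^ 2) :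
    ENNReal.ofReal (Real.exp (-1) / 8 * (d * s / N)) ≤
      minimaxRisk N (fullyLocalized d q) σ2 := by
  have hN0 : (0 : ℝ) < N := by exact_mod_cast hN
  obtain ⟨n, rfl⟩ : ∃ n, d = n + 1 := ⟨d - 1, by omega⟩
  set a := √(s / N) with ha_def
  have ha : 0 < a := Real.sqrt_pos.2 (by positivity)
  have ha2 : a ^ 2 = s / N := Real.sq_sqrt (by positivity)
  set K : Finset (Fin (n + 1)) := Finset.univ.erase (Fin.last n) with hK
  have hcard : K.card = n := by simp [hK]
  -- Noisy models follow the vertex at offset `q t`; precise ones do not depend on `v`, and their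
  -- height on the axis makes the distance to every vertex exactly `|q t|`.
  let θ : (Fin (n + 1) → Bool) → ModelIdx T → Vec (n + 1) := fun v t =>
    if s ≤ σ2 t then cubeVertex K a v + EuclideanSpace.single (Fin.last n) (q t)
    else EuclideanSpace.single (Fin.last n) (√(q t ^ 2 - n * a ^ 2))
  have hθ0 : ∀ v, θ v 0 = cubeVertex K a v := fun v => by simp [θ, h0, hq]
  have key := le_minimaxRisk_of_hypercube (Ψ := fullyLocalized (n + 1) q) (σ2 := σ2) hN θ ?_ K ha
    ?_ ?_
  · refine le_trans (ENNReal.ofReal_le_ofReal ?_) key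
    rw [hcard, ha2]
    have hn : (1 : ℝ) ≤ n := by exact_mod_cast (by omega : 1 ≤ n)
    have : 0 < Real.exp (-1) * (s / N) := by positivity
    push_cast
    -- The axis costs one of the `n + 1` directions; `n + 1 ≤ 2n` pays for it by halving the
    -- constant.
    calc Real.exp (-1) / 8 * (((n : ℝ) + 1) * s / N)
        = (n + 1) / 8 * (Real.exp (-1) * (s / N)) := by ring
      _ ≤ n / 4 * (Real.exp (-1) * (s / N)) :=
        mul_le_mul_of_nonneg_right (by linarith) this.le
      _ = _ := by ring
  · refine fun v => Set.mem_iUnion.2 ⟨1, fun t => ?_⟩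
    simp only [Equiv.Perm.coe_one, id_eq]
    rw [hθ0]
    by_cases ht : s ≤ σ2 t.succ
    · simp [θ, ht]
    · simp only [θ, ht, if_false]
      have hle : (n : ℝ) * a ^ 2 ≤ q t.succ ^ 2 := by
        refine le_trans ?_ (hfar _ (not_le.1 ht))
        rw [ha2, mul_div_assoc]
        gcongr
        simp
      rw [norm_single_sub_cubeVertex_sq, Real.sq_sqrt (by linarith)]
      ring
  · intro v k hk
    rw [hθ0, hθ0, cubeVertex_sub_flipAt_sq a v hk]
  · intro v k hk t
    by_cases ht : s ≤ σ2 t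
    · simp only [θ, ht, if_true]
      refine ⟨fun j hj => by simp [cubeVertex_flipAt_of_ne K a v hj], ?_⟩
      simp only [PiLp.add_apply, add_sub_add_right_eq_sub]
      rw [cubeVertex_sub_flipAt_sq a v hk, mul_pow, ha2]
      have : (N : ℝ) * (2 ^ 2 * (s / N)) = 4 * s := by field_simp; norm_num
      rw [this]
      gcongr
    · simp [θ, ht]

/-- If the radius `r` is within the accuracy of `N` target samples, then knowing that some source
is at distance `r` from the target does not allow to estimate better than up to `r`. -/
theorem le_minimaxRisk_singleLocalized {N d T : ℕ} (hN : 1 ≤ N) (hd : 1 ≤ d) (hT : 1 ≤ T)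
    {σ2 : ModelIdx T → ℝ≥0} {r : ℝ} (hr : r ≠ 0) (h : r ^ 2 ≤ d * σ2 0 / N) :
    ENNReal.ofReal (Real.exp (-1) / 4 * r ^ 2) ≤ minimaxRisk N (singleLocalized d T r) σ2 := by
  have hN0 : (0 : ℝ) < N := by exact_mod_cast hN
  have hd0 : (0 : ℝ) < d := by exact_mod_cast hd
  have hr2 : 0 < r ^ 2 := by positivity
  set a := √(r ^ 2 / d) with ha_def
  have ha : 0 < a := Real.sqrt_pos.2 (by positivity)
  have ha2 : a ^ 2 = r ^ 2 / d := Real.sq_sqrt (by positivity)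
  have hda : (d : ℝ) * a ^ 2 = r ^ 2 := by rw [ha2]; field_simp
  let θ : (Fin d → Bool) → ModelIdx T → Vec d := fun v t =>
    if t = 0 then cubeVertex Finset.univ a v else 0
  have key := le_minimaxRisk_of_hypercube (Ψ := singleLocalized d T r) (σ2 := σ2) hN θ ?_
    Finset.univ ha ?_ ?_
  · simpa [hda] using key
  · refine fun v => ⟨⟨0, hT⟩, ?_⟩
    simp [θ, norm_cubeVertex_sq, hda]
  · intro v k hk
    simp only [θ, if_true]
    exact cubeVertex_sub_flipAt_sq a v hk
  · intro v k hk t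
    by_cases ht : t = 0
    · subst ht
      simp only [θ, if_true]
      refine ⟨fun j hj => by simp [cubeVertex_flipAt_of_ne _ a v hj], ?_⟩
      rw [cubeVertex_sub_flipAt_sq a v hk, mul_pow, ha2]
      rw [le_div_iff₀ hN0] at h
      have : (N : ℝ) * (2 ^ 2 * (r ^ 2 / d)) = 4 * (r ^ 2 * N / d) := by ring
      rw [this]
      gcongr
      rw [div_le_iff₀ hd0]
      linarith
    · simp [θ, ht]

/-- Fits the constant `e^{-5}` of the theorem to the `e^{-1}/4` of the hypercube bound. -/
theorem exp_neg_five_sq_le : Real.exp (-5) ^ 2 ≤ Real.exp (-1) / 4 := by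
  have h1 : Real.exp (-5) ^ 2 = Real.exp (-1) * Real.exp (-9) := by
    rw [← Real.exp_nat_mul, ← Real.exp_add]
    norm_num
  have h2 : Real.exp (-9) ≤ 1 / 4 := by
    rw [Real.exp_neg, ← one_div]
    gcongr
    linarith [Real.add_one_le_exp (9 : ℝ)]
  rw [h1, div_eq_mul_one_div]
  gcongr

end CurriculumLearning

/-! ### The theorem -/

open CurriculumLearning

theorem theorem4 (d : ℕ) (hd : 3 ≤ d) :
    ∃ c : ℝ, Real.exp (-5) ≤ c ∧
      ∀ (N T : ℕ) (_ : 1 ≤ N) (σ2 : CurriculumLearning.ModelIdx T → NNReal)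
        (q : CurriculumLearning.ModelIdx T → ℝ)
        (_ : q 0 = 0) (_ : Monotone fun t => q t ^ 2) (_ : Antitone σ2)
        (tw : CurriculumLearning.ModelIdx T)
        (_ : CurriculumLearning.IsWeakOracleModel σ2 q
          (CurriculumLearning.weakOracleSet 1 N d σ2 q) tw),
        (q tw ^ 2 ≤ d * σ2 tw / N →
          ENNReal.ofReal (c ^ 2 / 2 * (d * σ2 tw / N)) ≤
              CurriculumLearning.minimaxRisk N (CurriculumLearning.fullyLocalized d q) σ2 ∧
            ((CurriculumLearning.weakOracleSet 1 N d σ2 q).Nonempty →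
              CurriculumLearning.minimaxRisk N (CurriculumLearning.fullyLocalized d q) σ2 ≤
                CurriculumLearning.minimaxRisk N
                  (CurriculumLearning.singleLocalized d T (q tw)) σ2)) ∧
        (d * σ2 tw / N < q tw ^ 2 →
          ENNReal.ofReal (c ^ 2 / 8 * q tw ^ 2) ≤
            CurriculumLearning.minimaxRisk N
              (CurriculumLearning.singleLocalized d T (q tw)) σ2) := by
  refine ⟨Real.exp (-5), le_rfl, ?_⟩
  intro N T hN σ2 q hq0 _ hσ tw htw
  have hc := exp_neg_five_sq_le
  have hc0 := Real.exp_pos (-1)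
  have hσ0 : (σ2 tw : ℝ) ≤ σ2 0 := by exact_mod_cast hσ (Fin.zero_le tw)
  refine ⟨fun _ => ⟨?_, fun hne => ?_⟩, fun hlt => ?_⟩
  · rcases eq_or_ne (σ2 tw) 0 with hz | hz
    · simp [hz]
    refine le_trans (ENNReal.ofReal_le_ofReal ?_) (le_minimaxRisk_fullyLocalized (s := σ2 tw) hN
      (by omega) hq0 (by positivity) hσ0 fun t ht => ?_)
    · exact mul_le_mul_of_nonneg_right (by linarith) (by positivity)
    -- A model more precise than the oracle's is outside the weak-oracle set by minimality (or
    -- because that set is empty), and it is not the target, whose variance is maximal. Hence `q_t²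
    -- > dσ_0²/N ≥ dσ_wo²/N`.
    · have hmem : t ∉ weakOracleSet 1 N d σ2 q := by
        intro hmem
        rcases htw with ⟨hS, _⟩ | ⟨_, hmin, _⟩
        · simp [hS] at hmem
        · exact absurd (hmin t hmem) (not_le.2 (by exact_mod_cast ht))
      have ht0 : t ≠ 0 := by
        rintro rfl
        exact absurd hσ0 (not_le.2 ht)
      have : d * (σ2 0 : ℝ) / N < q t ^ 2 := by
        by_contra hle
        exact hmem ⟨ht0, by rw [one_mul]; exact not_lt.1 hle⟩
      refine le_trans ?_ this.le
      gcongr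
  · rcases htw with ⟨hS, _⟩ | ⟨hmem, _⟩
    · exact absurd hS hne.ne_empty
    · exact minimaxRisk_mono (fullyLocalized_subset_singleLocalized q hmem.1) σ2
  -- A nonzero `q tw` rules out the target as oracle model, so `tw` lies in the weak-oracle set,
  -- whose defining inequality is the radius condition needed.
  · have hq : q tw ≠ 0 := by
      intro h
      rw [h, zero_pow two_ne_zero] at hlt
      exact absurd hlt (not_lt.2 (by positivity))
    rcases htw with ⟨_, rfl⟩ | ⟨hmem, _⟩
    · exact absurd hq0 hq
    have hT : 1 ≤ T := by
      by_contra hT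
      obtain rfl : T = 0 := by omega
      exact hmem.1 (Subsingleton.elim (α := Fin 1) _ _)
    refine le_trans (ENNReal.ofReal_le_ofReal ?_) (le_minimaxRisk_singleLocalized hN (by omega) hT
      hq (by simpa using hmem.2))
    exact mul_le_mul_of_nonneg_right (by linarith [sq_nonneg (Real.exp (-5))]) (sq_nonneg _)
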